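/- Let $d,s\ge 0$ be integers, let $f=(f_1,\dots,f_s)$ be a finite family of polynomials in $\mathbb{R}[x_1,\dots,x_d]$, and put \[ K(f)=\{x\in\mathbb{R}^d : f_i(x)\ge 0 \text{ for } i=1,\dots,s\}, \] \[ Q(f)=\{\sigma_0+\sigma_1f_1+\cdots+\sigma_sf_s : \sigma_0,\dots,\sigma_s \text{ are finite sums of squares of polynomials in } \mathbb{R}[x_1,\dots,x_d]\}. \] Assume that the quadratic module $Q(f)$ is Archimedean, i.e. that for every $p\in\mathbb{R}[x_1,\dots,x_d]$ there is a real $\lambda>0$ with $\lambda+p\in Q(f)$ and $\lambda-p\in Q(f)$. Let $L:\mathbb{R}[x_1,\dots,x_d]\to\mathbb{R}$ be a linear functional that is $Q(f)$-positive, i.e. $L(h)\ge 0$ for all $h\in Q(f)$. Then $L$ is a $K(f)$-moment functional: there exists a nonnegative Radon measure $\mu$ on $\mathbb{R}^d$, supported on $K(f)$ (that is, $\operatorname{supp}\mu\subseteq K(f)$), such that every polynomial $p\in\mathbb{R}[x_1,\dots,x_d]$ is $\mu$-integrable on $K(f)$ and \[ L(p)=\int_{K(f)} p\,d\mu\qquad\text{for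 all } p\in\mathbb{R}[x_1,\dots,x_d]. \] -/

import Mathlib

open MeasureTheory

/-- The basic closed semialgebraic set `K(f) = {x ∈ ℝ^d : f_i(x) ≥ 0 for all i}`. -/
def basicClosedSemialgebraicSet {d s : ℕ} (f : Fin s → MvPolynomial (Fin d) ℝ) :
    Set (Fin d → ℝ) :=
  {x | ∀ i, 0 ≤ MvPolynomial.eval x (f i)}

/-- The quadratic module `Q(f)`: all `σ₀ + σ₁ f₁ + ⋯ + σ_s f_s` whose coefficients
`σ₀, …, σ_s` are sums of squares of polynomials. -/
def generatedQuadraticModule {d s : ℕ} (f : Fin s → MvPolynomial (Fin d) ℝ) :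
    Set (MvPolynomial (Fin d) ℝ) :=
  {h | ∃ (σ₀ : MvPolynomial (Fin d) ℝ) (σ : Fin s → MvPolynomial (Fin d) ℝ),
    IsSumSq σ₀ ∧ (∀ i, IsSumSq (σ i)) ∧ h = σ₀ + ∑ i, σ i * f i}

/-- The `Q`-bounded elements of a commutative `ℝ`-algebra: those `a` for which
`c + a` and `c - a` lie in `Q` for some real `c > 0`. -/
def boundedElements {A : Type*} [CommRing A] [Algebra ℝ A] (Q : Set A) : Set A :=
  {a | ∃ c : ℝ, 0 < c ∧ algebraMap ℝ A c + a ∈ Q ∧ algebraMap ℝ A c - a ∈ Q}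

/-- `Q` is Archimedean if every element of the algebra is `Q`-bounded. -/
def IsArchimedeanModule {A : Type*} [CommRing A] [Algebra ℝ A] (Q : Set A) : Prop :=
  boundedElements Q = Set.univ

/-- A linear functional is `Q`-positive if it is nonnegative on `Q`. -/
def IsPositiveOn {A : Type*} [CommRing A] [Algebra ℝ A] (Q : Set A) (L : A →ₗ[ℝ] ℝ) : Prop :=
  ∀ h ∈ Q, 0 ≤ L h

/-- `L` is a `K`-moment functional: there is a nonnegative Radon measure `μ` on `ℝ^d` with
`supp μ ⊆ K` for which every polynomial is integrable on `K`, with integral `L p`.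
Only the topology and the Borel sets of `ℝ^d` matter, so `ℝ^d` is `Fin d → ℝ`. -/
def IsMomentFunctional {d : ℕ} (K : Set (Fin d → ℝ))
    (L : MvPolynomial (Fin d) ℝ →ₗ[ℝ] ℝ) : Prop :=
  ∃ μ : Measure (Fin d → ℝ), μ.Regular ∧ μ.support ⊆ K ∧
    ∀ p : MvPolynomial (Fin d) ℝ,
      IntegrableOn (fun x => MvPolynomial.eval x p) K μ ∧
        L p = ∫ x in K, MvPolynomial.eval x p ∂μ

/-! The normalized `Q`-positive functionals form a convex set, compact for pointwise convergence
because `Q` is Archimedean. By Krein–Milman, inequalities need only be tested at its extreme points.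
These are characters: if `1 - a ^ 2 ∈ Q`, then `L` is the sum of `L (a ^ 2 * ·)` and `L ((1 - a ^ 2)
* ·)`, both `Q`-positive, so extremality makes both proportional to `L`. The crux is positivity of
the second summand (`IsPositiveOn.sub_sqTwist`). For `Q(f)`, positive characters are evaluations at
points of `K(f)`; hence `L p ≥ 0` whenever `p ≥ 0` on the compact set `K(f)`, and Riesz extension
with Riesz–Markov–Kakutani yields the measure. -/

open CompactlySupported

/-- A quadratic module of a commutative `ℝ`-algebra: a set containing `1`, closed under addition
and under multiplication by squares. -/
structure IsQuadraticModule {A : Type*} [CommRing A] (Q : Set A) : Prop where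
  one_mem : 1 ∈ Q
  add_mem : ∀ {a b : A}, a ∈ Q → b ∈ Q → a + b ∈ Q
  sq_mul_mem : ∀ (a : A) {b : A}, b ∈ Q → a ^ 2 * b ∈ Q

/-- A nonnegative sequence with `u (k+1) ^ 2 ≤ u k * u (k+2)` that is bounded satisfies
`u 1 ≤ u 0`. -/
theorem le_of_logConvex_of_bounded {u : ℕ → ℝ} {C : ℝ} (h0 : ∀ k, 0 ≤ u k)
    (hlog : ∀ k, u (k + 1) ^ 2 ≤ u k * u (k + 2)) (hC : ∀ k, u k ≤ C) : u 1 ≤ u 0 := by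
  by_contra! hlt
  -- The ratios `u (k + 1) / u k` are nondecreasing, so all are at least `u 1 / u 0 > 1`; geometric
  -- growth then contradicts boundedness.
  have hmono : ∀ k, 0 < u (k + 1) ∧ u 1 * u k ≤ u (k + 1) * u 0 := by
    intro k
    induction k with
    | zero => exact ⟨(h0 0).trans_lt hlt, le_rfl⟩
    | succ k ih =>
      obtain ⟨hpos, hle⟩ := ih
      have hk : 0 < u k := by
        refine lt_of_le_of_ne (h0 k) fun h => ?_
        have := hlog k
        rw [← h, zero_mul] at this
        exact absurd this (not_le.2 (by positivity))
      have hk2 : 0 < u (k + 2) := by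
        refine lt_of_le_of_ne (h0 _) fun h => ?_
        have := hlog k
        rw [← h, mul_zero] at this
        exact absurd this (not_le.2 (by positivity))
      refine ⟨hk2, ?_⟩
      have h1 : u 1 * u (k + 1) * u k ≤ u (k + 2) * u 0 * u k := by
        calc u 1 * u (k + 1) * u k = u (k + 1) * (u 1 * u k) := by ring
          _ ≤ u (k + 1) * (u (k + 1) * u 0) := by gcongr
          _ = u (k + 1) ^ 2 * u 0 := by ring
          _ ≤ u k * u (k + 2) * u 0 := mul_le_mul_of_nonneg_right (hlog k) (h0 0)
          _ = u (k + 2) * u 0 * u k := by ring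
      exact le_of_mul_le_mul_right h1 hk
  rcases (h0 0).eq_or_lt with h | h
  · have := hlog 0
    rw [← h, zero_mul] at this
    exact absurd this (not_le.2 (by have := (hmono 0).1; positivity))
  · have hr : 1 < u 1 / u 0 := (one_lt_div h).2 hlt
    have hpow : ∀ k, (u 1 / u 0) ^ k * u 0 ≤ u k := by
      intro k
      induction k with
      | zero => simp
      | succ k ih =>
        calc (u 1 / u 0) ^ (k + 1) * u 0 = u 1 / u 0 * ((u 1 / u 0) ^ k * u 0) := by ring
          _ ≤ u 1 / u 0 * u k := by gcongr
          _ = u 1 * u k / u 0 := by ring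
          _ ≤ u (k + 1) := (div_le_iff₀ h).2 (hmono k).2
    obtain ⟨n, hn⟩ := pow_unbounded_of_one_lt (C / u 0) hr
    rw [div_lt_iff₀ h] at hn
    exact absurd ((hpow n).trans (hC n)) (not_le.2 hn)

/-! ### Positive functionals on an Archimedean quadratic module -/

section States

variable {A : Type*} [CommRing A] [Algebra ℝ A] {Q : Set A}

theorem IsArchimedeanModule.exists_bound (hA : IsArchimedeanModule Q) (a : A) :
    ∃ c : ℝ, 0 < c ∧ algebraMap ℝ A c + a ∈ Q ∧ algebraMap ℝ A c - a ∈ Q := by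
  have : a ∈ boundedElements Q := hA ▸ Set.mem_univ a
  exact this

theorem map_algebraMap_eq (L : A →ₗ[ℝ] ℝ) (c : ℝ) : L (algebraMap ℝ A c) = c * L 1 := by
  rw [Algebra.algebraMap_eq_smul_one, map_smul, smul_eq_mul]

theorem IsQuadraticModule.smul_mem (hQ : IsQuadraticModule Q) {c : ℝ} (hc : 0 ≤ c) {a : A}
    (ha : a ∈ Q) : algebraMap ℝ A c * a ∈ Q := by
  have := hQ.sq_mul_mem (algebraMap ℝ A √c) ha
  rwa [← map_pow, Real.sq_sqrt hc] at this

theorem IsPositiveOn.abs_le {L : A →ₗ[ℝ] ℝ} (hL : IsPositiveOn Q L) {a : A} {c : ℝ}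
    (h1 : algebraMap ℝ A c + a ∈ Q) (h2 : algebraMap ℝ A c - a ∈ Q) : |L a| ≤ c * L 1 := by
  have h1 := hL _ h1
  have h2 := hL _ h2
  rw [map_add, map_algebraMap_eq] at h1
  rw [map_sub, map_algebraMap_eq] at h2
  exact _root_.abs_le.2 ⟨by linarith, by linarith⟩

theorem IsPositiveOn.eq_zero_of_map_one {L : A →ₗ[ℝ] ℝ} (hA : IsArchimedeanModule Q)
    (hL : IsPositiveOn Q L) (h1 : L 1 = 0) : L = 0 := by
  ext a
  obtain ⟨c, -, h, h'⟩ := hA.exists_bound a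
  have := IsPositiveOn.abs_le hL h h'
  rw [h1, mul_zero] at this
  simpa using this

/-- The functional `h ↦ L (a ^ 2 * h)`. -/
def sqTwist (L : A →ₗ[ℝ] ℝ) (a : A) : A →ₗ[ℝ] ℝ := L ∘ₗ LinearMap.mulLeft ℝ (a ^ 2)

@[simp]
theorem sqTwist_apply (L : A →ₗ[ℝ] ℝ) (a h : A) : sqTwist L a h = L (a ^ 2 * h) := rfl

theorem IsPositiveOn.sqTwist (hQ : IsQuadraticModule Q) {L : A →ₗ[ℝ] ℝ} (hL : IsPositiveOn Q L)
    (a : A) : IsPositiveOn Q (sqTwist L a) := fun _ hh => hL _ (hQ.sq_mul_mem a hh)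

/-- If `1 - a ^ 2` lies in an Archimedean quadratic module `Q` and `L` is `Q`-positive, then so is
`h ↦ L ((1 - a ^ 2) * h)`. -/
theorem IsPositiveOn.sub_sqTwist (hQ : IsQuadraticModule Q) (hA : IsArchimedeanModule Q)
    {L : A →ₗ[ℝ] ℝ} (hL : IsPositiveOn Q L) {a : A} (ha : 1 - a ^ 2 ∈ Q) :
    IsPositiveOn Q (L - _root_.sqTwist L a) := by
  intro g hg
  rw [LinearMap.sub_apply, sqTwist_apply, sub_nonneg]
  -- `Q` need not be closed under products, so `(1 - a ^ 2) * g ∈ Q` is not available; the growth of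
  -- `L (a ^ (2 * k) * g)` in `k` is used instead.
  have hnn : ∀ b : A, 0 ≤ L (b ^ 2 * g) := fun b => hL _ (hQ.sq_mul_mem b hg)
  obtain ⟨c, hc, -, hcg⟩ := hA.exists_bound g
  have hone : ∀ k, L ((a ^ k) ^ 2) ≤ L 1 := by
    intro k
    induction k with
    | zero => simp
    | succ k ih =>
      have := hL _ (hQ.sq_mul_mem (a ^ k) ha)
      rw [mul_sub, mul_one, map_sub, ← mul_pow, ← pow_succ] at this
      linarith
  have key := le_of_logConvex_of_bounded (u := fun k => L ((a ^ k) ^ 2 * g)) (C := c * L 1)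
    (fun k => hnn _) (fun k => ?_) (fun k => ?_)
  · simpa using key
  -- Cauchy–Schwarz for the form `(x, y) ↦ L (x * y * g)`, applied to `a ^ k` and `a ^ (k + 2)`.
  · have hquad : ∀ t : ℝ, 0 ≤ L ((a ^ k) ^ 2 * g) * (t * t) +
        2 * L ((a ^ (k + 1)) ^ 2 * g) * t + L ((a ^ (k + 2)) ^ 2 * g) := by
      intro t
      have h := hnn (a ^ k * (algebraMap ℝ A t + a ^ 2))
      have e : (a ^ k * (algebraMap ℝ A t + a ^ 2)) ^ 2 * g =
          (t * t) • ((a ^ k) ^ 2 * g) + (2 * t) • ((a ^ (k + 1)) ^ 2 * g) +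
            (a ^ (k + 2)) ^ 2 * g := by
        simp only [Algebra.smul_def, map_mul, map_ofNat]
        ring
      rw [e, map_add, map_add, map_smul, map_smul, smul_eq_mul, smul_eq_mul] at h
      linarith
    have := discrim_le_zero hquad
    rw [discrim] at this
    nlinarith
  · have := hL _ (hQ.sq_mul_mem (a ^ k) hcg)
    rw [mul_sub, map_sub, mul_comm, ← Algebra.smul_def, map_smul, smul_eq_mul] at this
    have := mul_le_mul_of_nonneg_left (hone k) hc.le
    linarith

/-- The normalized `Q`-positive linear functionals, as a subset of `A → ℝ` with the topology of
pointwise convergence. -/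
def positiveStates (Q : Set A) : Set (A → ℝ) :=
  {φ | ∃ L : A →ₗ[ℝ] ℝ, IsPositiveOn Q L ∧ L 1 = 1 ∧ ⇑L = φ}

theorem convex_positiveStates (Q : Set A) : Convex ℝ (positiveStates Q) := by
  rintro _ ⟨L, hL, hL1, rfl⟩ _ ⟨M, hM, hM1, rfl⟩ s t hs ht hst
  refine ⟨s • L + t • M, fun h hh => ?_, ?_, rfl⟩
  · exact add_nonneg (mul_nonneg hs (hL h hh)) (mul_nonneg ht (hM h hh))
  · simp [hL1, hM1, hst]

/-- The Archimedean bounds confine the states to a product of compact intervals, and the defining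
conditions are closed. -/
theorem isCompact_positiveStates (hA : IsArchimedeanModule Q) : IsCompact (positiveStates Q) := by
  choose c hc hc1 hc2 using hA.exists_bound
  refine (isCompact_univ_pi fun a => isCompact_Icc (a := -c a) (b := c a)).of_isClosed_subset ?_ ?_
  · have : positiveStates Q = Set.range ((↑) : (A →ₗ[ℝ] ℝ) → A → ℝ) ∩
        ({φ | φ 1 = 1} ∩ ⋂ h ∈ Q, {φ | 0 ≤ φ h}) := by
      ext φ
      constructor
      · rintro ⟨L, hL, hL1, rfl⟩
        exact ⟨⟨L, rfl⟩, hL1, Set.mem_iInter₂.2 hL⟩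
      · rintro ⟨⟨L, rfl⟩, hL1, hL⟩
        exact ⟨L, Set.mem_iInter₂.1 hL, hL1, rfl⟩
    rw [this]
    refine (LinearMap.isClosed_range_coe A ℝ (RingHom.id ℝ)).inter (IsClosed.inter ?_ ?_)
    · exact isClosed_eq (continuous_apply _) continuous_const
    · exact isClosed_biInter fun h _ => isClosed_le continuous_const (continuous_apply h)
  · rintro _ ⟨L, hL, hL1, rfl⟩ a -
    have := IsPositiveOn.abs_le hL (hc1 a) (hc2 a)
    rw [hL1, mul_one] at this
    exact abs_le.1 this

theorem IsQuadraticModule.exists_sq_le (hQ : IsQuadraticModule Q) (hA : IsArchimedeanModule Q)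
    (a : A) : ∃ r : ℝ, r ≠ 0 ∧ 1 - (algebraMap ℝ A r * a) ^ 2 ∈ Q := by
  obtain ⟨c, hc, -, h⟩ := hA.exists_bound (a ^ 2)
  refine ⟨√c⁻¹, (Real.sqrt_pos.2 (inv_pos.2 hc)).ne', ?_⟩
  have := hQ.smul_mem (inv_nonneg.2 hc.le) h
  rwa [mul_sub, ← map_mul, inv_mul_cancel₀ hc.ne', map_one,
    ← Real.sq_sqrt (inv_nonneg.2 hc.le), map_pow, ← mul_pow] at this

theorem map_sq_mul_of_mem_extremePoints (hQ : IsQuadraticModule Q) (hA : IsArchimedeanModule Q)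
    {L : A →ₗ[ℝ] ℝ} (hL : ⇑L ∈ (positiveStates Q).extremePoints ℝ) {a : A}
    (ha : 1 - a ^ 2 ∈ Q) (h : A) : L (a ^ 2 * h) = L (a ^ 2) * L h := by
  obtain ⟨⟨L', hpos, hone, hLL'⟩, hext⟩ := hL
  obtain rfl : L' = L := DFunLike.coe_injective hLL'
  have hp1 : IsPositiveOn Q (sqTwist L' a) := hpos.sqTwist hQ a
  have hp2 := hpos.sub_sqTwist hQ hA ha
  have e1 : sqTwist L' a 1 = L' (a ^ 2) := by simp
  have e2 : (L' - sqTwist L' a) 1 = 1 - L' (a ^ 2) := by simp [hone]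
  have h1 := hp1 1 hQ.one_mem
  have h2 := hp2 1 hQ.one_mem
  rw [e1] at h1
  rw [e2] at h2
  -- If a summand vanishes at `1`, it cannot be normalized, but it is then identically zero.
  rcases h1.eq_or_lt with h1 | h1
  · have := LinearMap.congr_fun (hp1.eq_zero_of_map_one hA (e1.trans h1.symm)) h
    simpa [← h1] using this
  rcases h2.eq_or_lt with h2 | h2
  · have := LinearMap.congr_fun (hp2.eq_zero_of_map_one hA (e2.trans h2.symm)) h
    simp only [LinearMap.sub_apply, sqTwist_apply, LinearMap.zero_apply] at this
    have h3 : L' (a ^ 2) = 1 := by linarith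
    rw [h3]
    linarith
  have normalized : ∀ {M : A →ₗ[ℝ] ℝ}, IsPositiveOn Q M → 0 < M 1 →
      ⇑((M 1)⁻¹ • M) ∈ positiveStates Q := fun {M} hM hM1 =>
    ⟨_, fun g hg => mul_nonneg (inv_nonneg.2 hM1.le) (hM g hg), inv_mul_cancel₀ hM1.ne', rfl⟩
  have key := hext (normalized hp1 (e1 ▸ h1)) (normalized hp2 (e2 ▸ h2))
    ⟨L' (a ^ 2), 1 - L' (a ^ 2), h1, h2, by ring, ?_⟩
  · have := congrFun key h
    rw [e1, LinearMap.smul_apply, smul_eq_mul, sqTwist_apply, inv_mul_eq_iff_eq_mul₀ h1.ne'] at this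
    exact this
  · rw [e1, e2]
    ext g
    simp only [LinearMap.coe_smul, smul_inv_smul₀ h1.ne', smul_inv_smul₀ h2.ne', Pi.add_apply,
      LinearMap.sub_apply]
    ring

theorem map_mul_of_mem_extremePoints (hQ : IsQuadraticModule Q) (hA : IsArchimedeanModule Q)
    {L : A →ₗ[ℝ] ℝ} (hL : ⇑L ∈ (positiveStates Q).extremePoints ℝ) (a b : A) :
    L (a * b) = L a * L b := by
  -- Rescaling removes the condition `1 - c ^ 2 ∈ Q`; polarization then passes from squares to all
  -- `a`.
  have hsq : ∀ c : A, L (c ^ 2 * b) = L (c ^ 2) * L b := by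
    intro c
    obtain ⟨r, hr, hc⟩ := hQ.exists_sq_le hA c
    have := map_sq_mul_of_mem_extremePoints hQ hA hL hc b
    rw [mul_pow, ← map_pow, ← Algebra.smul_def, smul_mul_assoc, map_smul, map_smul, smul_eq_mul,
      smul_eq_mul, mul_assoc] at this
    exact mul_left_cancel₀ (pow_ne_zero 2 hr) this
  have e : (4 : ℝ) • a = (a + 1) ^ 2 - (a - 1) ^ 2 := by
    rw [Algebra.smul_def, map_ofNat]
    ring
  have h4 : L ((4 : ℝ) • a * b) = L ((4 : ℝ) • a) * L b := by
    rw [e, sub_mul, map_sub, map_sub, hsq, hsq, sub_mul]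
  rw [smul_mul_assoc, map_smul, map_smul, smul_eq_mul, smul_eq_mul, mul_assoc] at h4
  exact mul_left_cancel₀ four_ne_zero h4

/-- If `p` is nonnegative under every `Q`-positive character, then it is nonnegative under every
`Q`-positive linear functional. -/
theorem IsPositiveOn.nonneg_of_forall_algHom (hQ : IsQuadraticModule Q)
    (hA : IsArchimedeanModule Q) {L : A →ₗ[ℝ] ℝ} (hL : IsPositiveOn Q L) {p : A}
    (hp : ∀ χ : A →ₐ[ℝ] ℝ, (∀ h ∈ Q, 0 ≤ χ h) → 0 ≤ χ p) : 0 ≤ L p := by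
  have hsub : positiveStates Q ⊆ {φ | 0 ≤ φ p} := by
    rw [← closure_convexHull_extremePoints (isCompact_positiveStates hA) (convex_positiveStates Q)]
    refine closure_minimal (convexHull_min ?_ ?_)
      (isClosed_le continuous_const (continuous_apply p))
    · intro φ hφ
      obtain ⟨M, hM, hM1, rfl⟩ := hφ.1
      exact hp (AlgHom.ofLinearMap M hM1 (map_mul_of_mem_extremePoints hQ hA hφ)) hM
    · exact convex_halfSpace_ge (LinearMap.proj p : (A → ℝ) →ₗ[ℝ] ℝ).isLinear 0
  rcases (hL 1 hQ.one_mem).eq_or_lt with h | h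
  · rw [hL.eq_zero_of_map_one hA h.symm, LinearMap.zero_apply]
  · have : (L 1)⁻¹ * L p ≥ 0 := hsub ⟨(L 1)⁻¹ • L,
      fun g hg => mul_nonneg (inv_nonneg.2 h.le) (hL g hg), inv_mul_cancel₀ h.ne', rfl⟩
    exact (mul_nonneg_iff_of_pos_left (inv_pos.2 h)).1 this

end States

/-! ### Polynomials and representing measures -/

section Polynomial

open MvPolynomial

variable {d s : ℕ} {f : Fin s → MvPolynomial (Fin d) ℝ}

theorem isQuadraticModule_generatedQuadraticModule (f : Fin s → MvPolynomial (Fin d) ℝ) :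
    IsQuadraticModule (generatedQuadraticModule f) where
  one_mem := ⟨1, 0, by simp,
    fun _ => IsSumSq.zero, by simp⟩
  add_mem := by
    rintro _ _ ⟨σ, τ, hσ, hτ, rfl⟩ ⟨σ', τ', hσ', hτ', rfl⟩
    refine ⟨σ + σ', τ + τ', hσ.add hσ', fun i => (hτ i).add (hτ' i), ?_⟩
    simp only [Pi.add_apply, add_mul, Finset.sum_add_distrib]
    ring
  sq_mul_mem := by
    rintro a _ ⟨σ, τ, hσ, hτ, rfl⟩
    have ha : IsSumSq (a ^ 2) := by rw [sq]; exact IsSumSq.mul_self a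
    refine ⟨a ^ 2 * σ, fun i => a ^ 2 * τ i, ha.mul hσ, fun i => ha.mul (hτ i), ?_⟩
    simp only [mul_add, Finset.mul_sum, mul_assoc]

theorem mem_generatedQuadraticModule (f : Fin s → MvPolynomial (Fin d) ℝ) (i : Fin s) :
    f i ∈ generatedQuadraticModule f := by
  classical
  refine ⟨0, Pi.single i 1, IsSumSq.zero, fun j => ?_, by simp [Pi.single_apply]⟩
  rcases eq_or_ne j i with rfl | h
  · simp
  · simp [h]

theorem IsSumSq.eval_nonneg {σ : MvPolynomial (Fin d) ℝ} (hσ : IsSumSq σ) (x : Fin d → ℝ) :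
    0 ≤ eval x σ := by
  induction hσ with
  | zero => simp
  | sq_add a _ ih => simpa using add_nonneg (mul_self_nonneg _) ih

theorem eval_nonneg_of_mem_generatedQuadraticModule {h : MvPolynomial (Fin d) ℝ}
    (hh : h ∈ generatedQuadraticModule f) {x : Fin d → ℝ}
    (hx : x ∈ basicClosedSemialgebraicSet f) : 0 ≤ eval x h := by
  obtain ⟨σ, τ, hσ, hτ, rfl⟩ := hh
  rw [map_add, map_sum]
  refine add_nonneg (hσ.eval_nonneg x) (Finset.sum_nonneg fun i _ => ?_)
  rw [map_mul]
  exact mul_nonneg ((hτ i).eval_nonneg x) (hx i)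

theorem isClosed_basicClosedSemialgebraicSet (f : Fin s → MvPolynomial (Fin d) ℝ) :
    IsClosed (basicClosedSemialgebraicSet f) := by
  rw [basicClosedSemialgebraicSet, Set.ofPred_forall]
  exact isClosed_iInter fun i => isClosed_le continuous_const (MvPolynomial.continuous_eval (f i))

theorem isCompact_basicClosedSemialgebraicSet
    (hf : IsArchimedeanModule (generatedQuadraticModule f)) :
    IsCompact (basicClosedSemialgebraicSet f) := by
  choose c hc hc1 hc2 using fun i : Fin d => hf.exists_bound (X i)
  refine (isCompact_univ_pi fun i => isCompact_Icc (a := -c i) (b := c i)).of_isClosed_subset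
    (isClosed_basicClosedSemialgebraicSet f) fun x hx i _ => ?_
  have h1 := eval_nonneg_of_mem_generatedQuadraticModule (hc1 i) hx
  have h2 := eval_nonneg_of_mem_generatedQuadraticModule (hc2 i) hx
  simp only [map_add, map_sub, algebraMap_eq, eval_C, eval_X] at h1 h2
  exact ⟨by linarith, by linarith⟩

/-- A functional that is positive on an Archimedean `Q(f)` is nonnegative on the polynomials that
are nonnegative on `K(f)`. -/
theorem IsPositiveOn.nonneg_of_eval_nonneg
    (hf : IsArchimedeanModule (generatedQuadraticModule f)) {L : MvPolynomial (Fin d) ℝ →ₗ[ℝ] ℝ}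
    (hL : IsPositiveOn (generatedQuadraticModule f) L) {p : MvPolynomial (Fin d) ℝ}
    (hp : ∀ x ∈ basicClosedSemialgebraicSet f, 0 ≤ eval x p) : 0 ≤ L p := by
  refine hL.nonneg_of_forall_algHom (isQuadraticModule_generatedQuadraticModule f) hf
    fun χ hχ => ?_
  -- A character is evaluation at the point with coordinates `χ (X i)`.
  have hev : ∀ q, χ q = eval (fun i => χ (X i)) q := by
    intro q
    conv_lhs => rw [aeval_unique χ]
    rw [← coe_aeval_eq_eval]
    rfl
  rw [hev]
  refine hp _ fun i => ?_
  rw [← hev]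
  exact hχ _ (mem_generatedQuadraticModule f i)

/-- **Haviland's theorem** for compact sets. -/
theorem isMomentFunctional_of_nonneg {K : Set (Fin d → ℝ)} (hK : IsCompact K)
    {L : MvPolynomial (Fin d) ℝ →ₗ[ℝ] ℝ} (hL : ∀ p, (∀ x ∈ K, 0 ≤ eval x p) → 0 ≤ L p) :
    IsMomentFunctional K L := by
  have : CompactSpace K := isCompact_iff_compactSpace.1 hK
  let ev : MvPolynomial (Fin d) ℝ →ₗ[ℝ] C(K, ℝ) :=
    { toFun := fun p => ⟨fun x => eval x.1 p, (MvPolynomial.continuous_eval p).comp continuous_subtype_val⟩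
      map_add' := fun p q => by ext; simp
      map_smul' := fun c p => by ext; simp [smul_eval] }
  have hker : LinearMap.ker ev ≤ LinearMap.ker L := by
    intro p hp
    have hp0 : ∀ x ∈ K, eval x p = 0 := fun x hx =>
      DFunLike.congr_fun (LinearMap.mem_ker.1 hp) (⟨x, hx⟩ : K)
    have h1 := hL p fun x hx => (hp0 x hx).ge
    have h2 := hL (-p) fun x hx => by rw [map_neg, hp0 x hx, neg_zero]
    rw [map_neg] at h2
    exact le_antisymm (by linarith) h1
  -- By `hker`, `L p` depends only on `p` restricted to `K`, so `L` descends to the range of `ev`.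
  let F : C(K, ℝ) →ₗ.[ℝ] ℝ :=
    ⟨LinearMap.range ev, (LinearMap.ker ev).liftQ L hker ∘ₗ ev.quotKerEquivRange.symm.toLinearMap⟩
  have hF : ∀ p (hp : ev p ∈ F.domain), F ⟨ev p, hp⟩ = L p := by
    intro p hp
    change (LinearMap.ker ev).liftQ L hker (ev.quotKerEquivRange.symm ⟨ev p, hp⟩) = L p
    rw [LinearMap.quotKerEquivRange_symm_apply_image]
    rfl
  have hnonneg : ∀ g : F.domain, (g : C(K, ℝ)) ∈ PointedCone.positive ℝ C(K, ℝ) → 0 ≤ F g := by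
    rintro ⟨_, p, rfl⟩ hp
    exact (hL p fun x hx => hp ⟨x, hx⟩).trans_eq (hF p _).symm
  have hdense : ∀ g : C(K, ℝ), ∃ h : F.domain,
      (h : C(K, ℝ)) + g ∈ PointedCone.positive ℝ C(K, ℝ) := by
    intro g
    -- Constants are polynomials, and `‖g‖ + g ≥ 0`.
    refine ⟨⟨ev (C ‖g‖), C ‖g‖, rfl⟩, fun x => ?_⟩
    have := (abs_le.1 (g.norm_coe_le_norm x)).1
    have h2 : ev (C ‖g‖) x = ‖g‖ := eval_C _
    change 0 ≤ ev (C ‖g‖) x + g x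
    linarith
  obtain ⟨Λ, hΛ, hΛ0⟩ := riesz_extension (PointedCone.positive ℝ C(K, ℝ)) F hnonneg hdense
  have hΛL : ∀ p, Λ (ev p) = L p := fun p => (hΛ ⟨ev p, p, rfl⟩).trans (hF p _)
  let Λ' : C_c(K, ℝ) →ₚ[ℝ] ℝ := PositiveLinearMap.mk₀
    { toFun := fun g => Λ g.toContinuousMap
      map_add' := fun g h => map_add Λ g.toContinuousMap h.toContinuousMap
      map_smul' := fun c g => map_smul Λ c g.toContinuousMap }
    fun g hg => hΛ0 _ hg
  let ν := RealRMK.rieszMeasure Λ'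
  have hemb : MeasurableEmbedding ((↑) : K → Fin d → ℝ) :=
    MeasurableEmbedding.subtype_coe hK.measurableSet
  have hfin : IsFiniteMeasure ν := inferInstance
  have hae : ∀ᵐ x ∂(ν.map ((↑) : K → Fin d → ℝ)), x ∈ K :=
    (hemb.ae_map_iff).2 (Filter.Eventually.of_forall fun x => x.2)
  refine ⟨ν.map ((↑) : K → Fin d → ℝ), inferInstance,
    Measure.support_subset_of_isClosed hK.isClosed hae, fun p => ?_⟩
  rw [IntegrableOn, Measure.restrict_eq_self_of_ae_mem hae, hemb.integrable_map_iff,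
    hemb.integral_map]
  refine ⟨(ev p).continuous.integrable_of_hasCompactSupport (HasCompactSupport.of_compactSpace _),
    ?_⟩
  rw [← hΛL]
  exact (RealRMK.integral_rieszMeasure Λ'
    ⟨ev p, HasCompactSupport.of_compactSpace _⟩).symm

end Polynomial

theorem mainTheorem5 {d s : ℕ} (f : Fin s → MvPolynomial (Fin d) ℝ)
    (hf : IsArchimedeanModule (generatedQuadraticModule f))
    (L : MvPolynomial (Fin d) ℝ →ₗ[ℝ] ℝ)
    (hL : IsPositiveOn (generatedQuadraticModule f) L) :
    IsMomentFunctional (basicClosedSemialgebraicSet f) L :=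
  isMomentFunctional_of_nonneg (isCompact_basicClosedSemialgebraicSet hf)
    fun _ hp => hL.nonneg_of_eval_nonneg hf hp
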